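/- \textbf{Theorem.} Let $G=(V,E)$ be a finite connected multigraph without self-loops (parallel edges allowed, all edges of unit weight), and put $n=|V|$. For a graph $H$, a \emph{multiway cut} of $H$ is a partition $\mathcal P$ of $V(H)$ into at least two (nonempty) sides; $\partial\mathcal P$ is the set of edges of $H$ whose endpoints lie in different sides, and the \emph{cut ratio} of $\mathcal P$ is $|\partial\mathcal P|/(|\mathcal P|-1)$. A \emph{min-ratio cut} is a multiway cut of minimum cut ratio, and it is \emph{maximal} if it has the largest number of sides among all min-ratio cuts. A \emph{cut hierarchy} of $G$ is a rooted tree obtained by the following recursive process: if the current graph $H$ is a single vertex, stop; otherwise choose a min-ratio cut $\mathcal P$ of $H$ and recurse on the induced subgraphs $H[U]$ for all sides $U\in\mathcal P$. It is \emph{canonical} if every chosen min-ratio cut is maximal. Every edge $e$ lies in $\partial\mathcal P$ for exactly one multiway cut $\mathcal P$ of the hierarchy, and its \emph{ideal load} is the reciprocal of the cut ratio of that cut, $\ell(e)=(|\mathcal P|-1)/|\partial\mathcal P|$. The \emph{spanning tree polytope} $\mathbb T\subseteq\mathbb R^E$ is the set of all $x$ with $0\le x_e\le 1$ for all $e\in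 E$, $\sum_{e\in E[S]}x_e\le |S|-1$ for all nonempty $S\subseteq V$ (where $E[S]$ is the set of edges with both endpoints in $S$), and $\sum_{e\in E}x_e=n-1$. Then $G$ has a canonical cut hierarchy, and for every cut hierarchy of $G$ (in particular for a canonical one) the vector of ideal loads $\ell=(\ell(e))_{e\in E}$ belongs to $\mathbb T$ and is the unique maximizer over $\mathbb T$ of the entropy $$H(x)=\sum_{e\in E}\frac{x_e}{n-1}\ln\frac{n-1}{x_e};$$ equivalently, it is the unique minimizer of $\sum_{e\in E}x_e\ln x_e$ over $\mathbb T$ (with the convention that the summand for $x_e=0$ is $0$ in both sums; if $n=1$ there are no edges and the claim is trivial). -/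

import Mathlib

open scoped Graph

namespace Graph

universe u v

variable {α : Type u} {β : Type v}

/-- The set `∂P` of cut edges of a partition `P` of the vertex set of `H`: the edges of `H` whose
two endpoints lie in different sides of `P`. -/
def cutEdges (H : Graph α β) (P : Partition V(H)) : Set β :=
  {e | ∃ x y, H.IsLink e x y ∧ ∃ U ∈ P, ∃ W ∈ P, U ≠ W ∧ x ∈ U ∧ y ∈ W}

/-- The number `|P|` of sides of a partition of the vertex set. -/
noncomputable def numSides (H : Graph α β) (P : Partition V(H)) : ℕ :=
  (P : Set (Set α)).ncard

/-- A multiway cut is a partition of the vertex set into at least two sides. -/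
def IsMultiwayCut (H : Graph α β) (P : Partition V(H)) : Prop :=
  2 ≤ H.numSides P

/-- The cut ratio `d(P) / (|P| - 1)`, where `d(P) = |∂P|` since all edges have unit weight. -/
noncomputable def cutRatio (H : Graph α β) (P : Partition V(H)) : ℝ :=
  ((H.cutEdges P).ncard : ℝ) / ((H.numSides P : ℝ) - 1)

/-- A min-ratio cut: a multiway cut attaining the minimum cut ratio among all multiway cuts. -/
def IsMinRatioCut (H : Graph α β) (P : Partition V(H)) : Prop :=
  H.IsMultiwayCut P ∧ ∀ Q : Partition V(H), H.IsMultiwayCut Q → H.cutRatio P ≤ H.cutRatio Q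

/-- A maximal min-ratio cut: a min-ratio cut with the largest number of sides. -/
def IsMaximalMinRatioCut (H : Graph α β) (P : Partition V(H)) : Prop :=
  H.IsMinRatioCut P ∧ ∀ Q : Partition V(H), H.IsMinRatioCut Q → H.numSides Q ≤ H.numSides P

/-- A cut hierarchy of a graph `H`, as a rooted tree. If `H` has a single vertex, it is a leaf.
Otherwise the root carries a min-ratio cut `P` of `H`, and for each side `U` of `P` it has one child,
which is the root of a cut hierarchy of the induced subgraph `H[U]`. -/
inductive CutHierarchy : Graph α β → Type (max u v)
  | leaf (H : Graph α β) (hH : ∃ w, V(H) = {w}) : CutHierarchy H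
  | node (H : Graph α β) (P : Partition V(H)) (hP : H.IsMinRatioCut P)
      (child : ∀ U : P, CutHierarchy (H.induce (U : Set α))) : CutHierarchy H

/-- The hierarchy is canonical if a maximal min-ratio cut is chosen at every internal node. -/
def CutHierarchy.IsCanonical {H : Graph α β} : CutHierarchy H → Prop
  | .leaf _ _ => True
  | .node H P _ child => H.IsMaximalMinRatioCut P ∧ ∀ U : P, (child U).IsCanonical

open Classical in
/-- The ideal load of an edge `e`: the reciprocal of the cut ratio of the unique multiway cut of the
hierarchy that cuts `e`. If `e` is not cut at the root, both its endpoints lie in exactly one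
side `U`, and the search goes on in the hierarchy of the subgraph induced by `U`. -/
noncomputable def CutHierarchy.idealLoad {H : Graph α β} : CutHierarchy H → β → ℝ
  | .leaf _ _, _ => 0
  | .node H P _ child, e =>
      if e ∈ H.cutEdges P then 1 / H.cutRatio P
      else if h : ∃ U : P, e ∈ E(H.induce (U : Set α)) then (child h.choose).idealLoad e
      else 0

open Classical in
/-- The spanning tree polytope in `ℝ^E`: `0 ≤ x_e ≤ 1` for all edges `e`, `x(E[S]) ≤ |S| - 1` for
all nonempty vertex sets `S`, and `x(E) = |V| - 1`. -/
def spanningTreePolytope (G : Graph α β) [Fintype E(G)] : Set (E(G) → ℝ) :=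
  {x | (∀ e : E(G), 0 ≤ x e ∧ x e ≤ 1) ∧
    (∀ S : Set α, S ⊆ V(G) → S.Nonempty →
      ∑ e ∈ Finset.univ.filter (fun e : E(G) => (e : β) ∈ E(G.induce S)), x e ≤ (S.ncard : ℝ) - 1) ∧
    ∑ e : E(G), x e = (V(G).ncard : ℝ) - 1}

/-- The Shannon entropy of the edge values normalized by `|V| - 1`. The convention `0 ln (1/0) = 0`
is in force, since Lean evaluates the product as zero. -/
noncomputable def edgeEntropy (G : Graph α β) [Fintype E(G)] (x : E(G) → ℝ) : ℝ :=
  ∑ e : E(G), x e / ((V(G).ncard : ℝ) - 1) * Real.log (((V(G).ncard : ℝ) - 1) / x e)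

end Graph

/-!
The ideal loads of every cut hierarchy minimize `∑ x log x` over the spanning tree polytope, because
they satisfy the first-order optimality condition for this strictly convex function, as a greedy
solution does.

Call a graph `r`-strong if all of its multiway cuts have ratio at least `r`. Two exchange arguments
with a min-ratio cut `P` of ratio `r` drive the proof. Replacing a side `U` by the sides of a cut of
`H[U]` shows that `H[U]` is `r`-strong (`IsMinRatioCut.isStrong_induce`), so cut ratios do not
decrease down a hierarchy; in particular they are all positive, since every multiway cut of a
connected graph has an edge. Merging the `k` sides that meet a vertex set `S` shows that at most
`r (k - 1)` edges of `∂P` lie inside `S` (`IsMinRatioCut.ncard_edgeSet_induce_inter_cutEdges_le`).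
By induction on the hierarchy, the second fact gives `ℓ(E[S]) ≤ |S| - 1`, while the loads of `∂P`
add up to exactly `|P| - 1`, whence `ℓ(E) = |V| - 1`. The bound `ℓ(e) ≤ 1` is the constraint for the
two ends of `e`.

For optimality, the tangent line inequality for `t log t` reduces the claim to
`∑ (x e - ℓ e) log (ℓ e) ≥ 0` for `x` in the polytope. For the induction this is strengthened: if
`H` is `r`-strong and `x` satisfies only the inequalities `x(E[S]) ≤ |S| - 1`, then
`∑ (x e - ℓ e) (log (ℓ e) + log r) ≥ 0` (`CutHierarchy.finsum_sub_idealLoad_mul_nonneg`). Let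
`r' ≥ r` be the ratio of the root cut. The sum for `r` exceeds the sum for `r'` by
`(x(E) - ℓ(E)) (log r - log r') ≥ 0`; in the sum for `r'`, the root edges contribute zero and the
sides are covered by induction. At the top of the hierarchy `x(E) = ℓ(E)`, and `r` drops out. On the
hyperplane `x(E) = |V| - 1` the entropy is a decreasing affine function of `∑ x log x`.
-/

/-! ### Constructions with partitions of a set -/

namespace Partition

variable {α : Type*} {s U : Set α}

/-- The partition obtained from `P` by merging the parts in `K` into one part. -/
def merge (P : Partition s) (K : Set (Set α)) (hK : K ⊆ P) (hne : K.Nonempty) : Partition s where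
  parts := ((P : Set (Set α)) \ K) ∪ {⋃₀ K}
  sSupIndep' := by
    refine Set.PairwiseDisjoint.sSupIndep (Set.PairwiseDisjoint.union
      (P.pairwiseDisjoint.subset Set.sdiff_subset) (by simp) ?_)
    rintro A ⟨hA, hAK⟩ B rfl -
    refine Set.disjoint_sUnion_right.2 fun B hB => P.disjoint hA (hK hB) ?_
    rintro rfl
    exact hAK hB
  bot_notMem' := by
    rintro (⟨h, -⟩ | h)
    · exact P.bot_notMem h
    · obtain ⟨A, hA⟩ := hne
      obtain ⟨x, hx⟩ := P.nonempty_of_mem (hK hA)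
      have : x ∈ (⊥ : Set α) := by rw [h]; exact ⟨A, hA, hx⟩
      exact this
  sSup_eq' := by
    have h : (P : Set (Set α)) = ((P : Set (Set α)) \ K) ∪ K := by
      rw [Set.sdiff_union_of_subset hK]
    rw [sSup_union, sSup_singleton]
    conv_rhs => rw [← P.sSup_eq, h, sSup_union]
    rfl

/-- The partition obtained from `P` by replacing its part `U` with the parts of `Q`. -/
def refineAt (P : Partition s) (hU : U ∈ P) (Q : Partition U) : Partition s where
  parts := ((P : Set (Set α)) \ {U}) ∪ Q
  sSupIndep' := by
    refine Set.PairwiseDisjoint.sSupIndep (Set.PairwiseDisjoint.union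
      (P.pairwiseDisjoint.subset Set.sdiff_subset) Q.pairwiseDisjoint ?_)
    rintro A ⟨hA, hAU⟩ B hB -
    exact (P.disjoint hA hU hAU).mono_right (Q.le_of_mem hB)
  bot_notMem' := by
    rintro (⟨h, -⟩ | h)
    · exact P.bot_notMem h
    · exact Q.bot_notMem h
  sSup_eq' := by
    have h : (P : Set (Set α)) = ((P : Set (Set α)) \ {U}) ∪ {U} := by
      rw [Set.sdiff_union_of_subset (by simpa using hU)]
    rw [sSup_union, Q.sSup_eq]
    conv_rhs => rw [← P.sSup_eq, h, sSup_union, sSup_singleton]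

/-- The partition of a set into singletons. -/
def singletons (s : Set α) : Partition s where
  parts := (fun x => {x}) '' s
  sSupIndep' := by
    refine Set.PairwiseDisjoint.sSupIndep ?_
    rintro _ ⟨x, -, rfl⟩ _ ⟨y, -, rfl⟩ hxy
    exact Set.disjoint_singleton.2 fun h => hxy (congrArg _ h)
  bot_notMem' := by
    rintro ⟨x, -, h⟩
    exact Set.singleton_ne_empty x h
  sSup_eq' := by
    rw [sSup_image]
    exact Set.biUnion_of_singleton s

lemma ncard_singletons (s : Set α) : ((singletons s : Partition s) : Set (Set α)).ncard = s.ncard :=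
  Set.ncard_image_of_injective s Set.singleton_injective

lemma finite_parts (hs : s.Finite) (P : Partition s) : (P : Set (Set α)).Finite :=
  hs.finite_subsets.subset fun _ hA => P.subset_of_mem hA

lemma finite_of_finite (hs : s.Finite) : Finite (Partition s) := by
  have : Finite {A : Set (Set α) // A ∈ {A : Set (Set α) | A ⊆ {t | t ⊆ s}}} :=
    hs.finite_subsets.finite_subsets
  exact Finite.of_injective
    (fun P : Partition s => (⟨P, fun _ hA => P.subset_of_mem hA⟩ :
      {A : Set (Set α) // A ∈ {A : Set (Set α) | A ⊆ {t | t ⊆ s}}}))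
    fun P Q h => SetLike.coe_injective (congrArg Subtype.val h)

lemma ncard_merge (hs : s.Finite) (P : Partition s) (K : Set (Set α)) (hK : K ⊆ P)
    (hne : K.Nonempty) :
    (P.merge K hK hne : Set (Set α)).ncard + K.ncard = (P : Set (Set α)).ncard + 1 := by
  have hP := P.finite_parts hs
  have hnot : ⋃₀ K ∉ (P : Set (Set α)) \ K := by
    rintro ⟨h, h'⟩
    obtain ⟨A, hA⟩ := hne
    obtain ⟨x, hx⟩ := P.nonempty_of_mem (hK hA)
    exact h' (P.eq_of_mem_of_mem (hK hA) h hx ⟨A, hA, hx⟩ ▸ hA)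
  have h1 : (P.merge K hK hne : Set (Set α)) = insert (⋃₀ K) ((P : Set (Set α)) \ K) :=
    Set.union_singleton
  rw [h1, Set.ncard_insert_of_notMem hnot (hP.subset Set.sdiff_subset), add_right_comm,
    Set.ncard_sdiff_add_ncard_of_subset hK hP]

lemma ncard_refineAt (hs : s.Finite) (P : Partition s) (hU : U ∈ P) (Q : Partition U) :
    (P.refineAt hU Q : Set (Set α)).ncard + 1 =
      (P : Set (Set α)).ncard + (Q : Set (Set α)).ncard := by
  have hP := P.finite_parts hs
  have hdis : Disjoint ((P : Set (Set α)) \ {U}) (Q : Set (Set α)) := by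
    refine Set.disjoint_left.2 fun A ⟨hA, hAU⟩ hAQ => hAU ?_
    obtain ⟨x, hx⟩ := Q.nonempty_of_mem hAQ
    exact P.eq_of_mem_of_mem hA hU hx (Q.subset_of_mem hAQ hx)
  have h1 : (P.refineAt hU Q : Set (Set α)) = ((P : Set (Set α)) \ {U}) ∪ Q := rfl
  rw [h1, Set.ncard_union_eq hdis (hP.subset Set.sdiff_subset)
    (Q.finite_parts (hs.subset (P.subset_of_mem hU))), add_right_comm,
    Set.ncard_sdiff_singleton_add_one hU hP]

end Partition

namespace Graph

universe u v

variable {α : Type u} {β : Type v}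

/-! ### Cut edges and strength -/

lemma cutEdges_subset (H : Graph α β) (P : Partition V(H)) : H.cutEdges P ⊆ E(H) :=
  fun _ ⟨_, _, h, _⟩ => h.edge_mem

lemma IsLink.mem_cutEdges_iff {H : Graph α β} {P : Partition V(H)} {e : β} {x y : α} {U W : Set α}
    (h : H.IsLink e x y) (hU : U ∈ P) (hW : W ∈ P) (hx : x ∈ U) (hy : y ∈ W) :
    e ∈ H.cutEdges P ↔ U ≠ W := by
  refine ⟨?_, fun hne => ⟨x, y, h, U, hU, W, hW, hne, hx, hy⟩⟩
  rintro ⟨x', y', h', U', hU', W', hW', hne, hx', hy'⟩ rfl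
  obtain ⟨rfl, rfl⟩ | ⟨rfl, rfl⟩ := h.eq_and_eq_or_eq_and_eq h'
  · exact hne ((P.eq_of_mem_of_mem hU' hU hx' hx).trans (P.eq_of_mem_of_mem hU hW' hy hy'))
  · exact hne ((P.eq_of_mem_of_mem hU' hU hx' hy).trans (P.eq_of_mem_of_mem hU hW' hx hy'))

lemma notMem_cutEdges_of_mem_edgeSet_induce {H : Graph α β} {P : Partition V(H)} {U A : Set α}
    (hU : U ∈ P) (hA : A ⊆ U) {e : β} (he : e ∈ E(H.induce A)) : e ∉ H.cutEdges P := by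
  obtain ⟨x, y, h, hx, hy⟩ := he
  rw [h.mem_cutEdges_iff hU hU (hA hx) (hA hy)]
  simp

lemma edgeSet_induce_subset (H : Graph α β) (S : Set α) : E(H.induce S) ⊆ E(H) :=
  fun _ ⟨_, _, h, _⟩ => h.edge_mem

lemma edgeSet_induce_mono (H : Graph α β) {S T : Set α} (hST : S ⊆ T) :
    E(H.induce S) ⊆ E(H.induce T) :=
  fun _ ⟨x, y, h, hx, hy⟩ => ⟨x, y, h, hST hx, hST hy⟩

lemma edgeSet_induce_induce (H : Graph α β) {S T : Set α} (hST : S ⊆ T) :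
    E((H.induce T).induce S) = E(H.induce S) := by
  ext e
  constructor
  · rintro ⟨x, y, ⟨h, -⟩, hx, hy⟩
    exact ⟨x, y, h, hx, hy⟩
  · rintro ⟨x, y, h, hx, hy⟩
    exact ⟨x, y, ⟨h, hST hx, hST hy⟩, hx, hy⟩

/-- A graph is `r`-strong if every multiway cut of it has cut ratio at least `r`. The condition is
written without division. -/
def IsStrong (H : Graph α β) (r : ℝ) : Prop :=
  ∀ Q : Partition V(H), H.IsMultiwayCut Q →
    r * ((H.numSides Q : ℝ) - 1) ≤ ((H.cutEdges Q).ncard : ℝ)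

lemma IsMultiwayCut.numSides_sub_one_pos {H : Graph α β} {P : Partition V(H)}
    (hP : H.IsMultiwayCut P) : (0 : ℝ) < (H.numSides P : ℝ) - 1 := by
  have : (2 : ℝ) ≤ (H.numSides P : ℝ) := by exact_mod_cast hP
  linarith

lemma IsMultiwayCut.cutRatio_mul {H : Graph α β} {P : Partition V(H)} (hP : H.IsMultiwayCut P) :
    H.cutRatio P * ((H.numSides P : ℝ) - 1) = (H.cutEdges P).ncard :=
  div_mul_cancel₀ _ hP.numSides_sub_one_pos.ne'

lemma IsStrong.le_cutRatio {H : Graph α β} {r : ℝ} (hr : H.IsStrong r) {P : Partition V(H)}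
    (hP : H.IsMultiwayCut P) : r ≤ H.cutRatio P :=
  (le_div_iff₀ hP.numSides_sub_one_pos).2 (hr P hP)

lemma IsMinRatioCut.isStrong {H : Graph α β} {P : Partition V(H)} (hP : H.IsMinRatioCut P) :
    H.IsStrong (H.cutRatio P) :=
  fun Q hQ => (le_div_iff₀ hQ.numSides_sub_one_pos).1 (hP.2 Q hQ)

/-- Cut ratios do not decrease down a hierarchy: replacing the side `U` of a min-ratio cut by the
sides of a cut of `H[U]` gives a cut of `H`, whose ratio is a mediant of the two ratios. -/
lemma IsMinRatioCut.isStrong_induce {H : Graph α β} (hV : V(H).Finite) (hE : E(H).Finite)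
    {P : Partition V(H)} (hP : H.IsMinRatioCut P) {U : Set α} (hU : U ∈ P) :
    (H.induce U).IsStrong (H.cutRatio P) := by
  intro Q hQ
  have hcard : H.numSides (P.refineAt hU Q) + 1 = H.numSides P + (H.induce U).numSides Q :=
    P.ncard_refineAt hV hU Q
  have hcut : H.IsMultiwayCut (P.refineAt hU Q) := by
    have h1 := hP.1
    unfold IsMultiwayCut at h1 hQ ⊢
    omega
  have hsub : H.cutEdges (P.refineAt hU Q) ⊆ H.cutEdges P ∪ (H.induce U).cutEdges Q := by
    rintro e ⟨x, y, h, A, hA, B, hB, hne, hx, hy⟩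
    obtain ⟨A', hA', hxA'⟩ := P.mem_iff_exists.1 h.left_mem
    obtain ⟨B', hB', hyB'⟩ := P.mem_iff_exists.1 h.right_mem
    by_cases hAB : A' = B'
    · subst hAB
      right
      by_cases hAU : A' = U
      · subst hAU
        -- a part of the refinement that meets `U` is a part of `Q`
        have key : ∀ C ∈ P.refineAt hU Q, ∀ z ∈ C, z ∈ A' → C ∈ Q := by
          rintro C (⟨hC, hCU⟩ | hC) z hz hz'
          · exact (hCU (P.eq_of_mem_of_mem hC hA' hz hz')).elim
          · exact hC
        exact ⟨x, y, ⟨h, hxA', hyB'⟩, A, key A hA x hx hxA', B, key B hB y hy hyB', hne, hx, hy⟩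
      · have hm : A' ∈ P.refineAt hU Q := Or.inl ⟨hA', hAU⟩
        exact (hne ((Partition.eq_of_mem_of_mem hA hm hx hxA').trans
          (Partition.eq_of_mem_of_mem hm hB hyB' hy))).elim
    · exact Or.inl ⟨x, y, h, A', hA', B', hB', hAB, hxA', hyB'⟩
  have hfin : (H.cutEdges P ∪ (H.induce U).cutEdges Q).Finite :=
    (hE.subset (H.cutEdges_subset P)).union
      (hE.subset (((H.induce U).cutEdges_subset Q).trans (H.edgeSet_induce_subset U)))
  have hle : (H.cutEdges (P.refineAt hU Q)).ncard ≤
      (H.cutEdges P).ncard + ((H.induce U).cutEdges Q).ncard :=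
    (Set.ncard_le_ncard hsub hfin).trans (Set.ncard_union_le _ _)
  have h1 := hP.isStrong _ hcut
  have h2 := hP.1.cutRatio_mul
  have hcard' : (H.numSides (P.refineAt hU Q) : ℝ) + 1 =
      H.numSides P + (H.induce U).numSides Q := by exact_mod_cast hcard
  have hle' : ((H.cutEdges (P.refineAt hU Q)).ncard : ℝ) ≤
      (H.cutEdges P).ncard + ((H.induce U).cutEdges Q).ncard := by exact_mod_cast hle
  have h3 : (H.numSides (P.refineAt hU Q) : ℝ) =
      H.numSides P + (H.induce U).numSides Q - 1 := by linarith
  rw [h3] at h1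
  nlinarith

/-- At most `r (k - 1)` edges of a min-ratio cut of ratio `r` lie inside a vertex set meeting `k`
of its sides: merging these sides gives a cut avoiding all of these edges, and its ratio is at
least `r`. -/
lemma IsMinRatioCut.ncard_edgeSet_induce_inter_cutEdges_le {H : Graph α β} (hV : V(H).Finite)
    (hE : E(H).Finite) {P : Partition V(H)} (hP : H.IsMinRatioCut P) {S : Set α} (hS : S ⊆ V(H))
    (hne : S.Nonempty) :
    ((E(H.induce S) ∩ H.cutEdges P).ncard : ℝ) ≤
      H.cutRatio P * (({U ∈ (P : Set (Set α)) | (S ∩ U).Nonempty}.ncard : ℝ) - 1) := by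
  set K : Set (Set α) := {U ∈ (P : Set (Set α)) | (S ∩ U).Nonempty} with hKdef
  have hK : K ⊆ P := Set.sep_subset _ _
  have hKne : K.Nonempty := by
    obtain ⟨x, hx⟩ := hne
    obtain ⟨U, hU, hxU⟩ := P.mem_iff_exists.1 (hS hx)
    exact ⟨U, hU, x, hx, hxU⟩
  have hPE := hE.subset (H.cutEdges_subset P)
  have hcard := P.ncard_merge hV K hK hKne
  have h2 := hP.1.cutRatio_mul
  by_cases hm : H.IsMultiwayCut (P.merge K hK hKne)
  · have hdis : Disjoint (H.cutEdges (P.merge K hK hKne)) (E(H.induce S) ∩ H.cutEdges P) := by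
      refine Set.disjoint_left.2 ?_
      rintro e hem ⟨⟨x, y, h, hx, hy⟩, -⟩
      obtain ⟨U, hU, hxU⟩ := P.mem_iff_exists.1 (hS hx)
      obtain ⟨W, hW, hyW⟩ := P.mem_iff_exists.1 (hS hy)
      have hmem : ⋃₀ K ∈ P.merge K hK hKne := Or.inr rfl
      exact (h.mem_cutEdges_iff hmem hmem ⟨U, ⟨hU, x, hx, hxU⟩, hxU⟩
        ⟨W, ⟨hW, y, hy, hyW⟩, hyW⟩).1 hem rfl
    have hsub : H.cutEdges (P.merge K hK hKne) ⊆ H.cutEdges P := by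
      rintro e ⟨x, y, h, A, hA, B, hB, hAB, hx, hy⟩
      obtain ⟨A', hA', hxA'⟩ := P.mem_iff_exists.1 h.left_mem
      obtain ⟨B', hB', hyB'⟩ := P.mem_iff_exists.1 h.right_mem
      refine ⟨x, y, h, A', hA', B', hB', ?_, hxA', hyB'⟩
      rintro rfl
      obtain ⟨C, hC, hA'C⟩ : ∃ C ∈ P.merge K hK hKne, A' ⊆ C := by
        by_cases hA'K : A' ∈ K
        · exact ⟨_, Or.inr rfl, Set.subset_sUnion_of_mem hA'K⟩
        · exact ⟨A', Or.inl ⟨hA', hA'K⟩, subset_rfl⟩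
      exact hAB ((Partition.eq_of_mem_of_mem hA hC hx (hA'C hxA')).trans
        (Partition.eq_of_mem_of_mem hC hB (hA'C hyB') hy))
    have hle : (H.cutEdges (P.merge K hK hKne)).ncard + (E(H.induce S) ∩ H.cutEdges P).ncard ≤
        (H.cutEdges P).ncard := by
      rw [← Set.ncard_union_eq hdis (hPE.subset hsub) (hPE.subset Set.inter_subset_right)]
      exact Set.ncard_le_ncard (Set.union_subset hsub Set.inter_subset_right) hPE
    have h1 := hP.isStrong _ hm
    have hcard' : (H.numSides (P.merge K hK hKne) : ℝ) = H.numSides P + 1 - K.ncard := by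
      rw [eq_sub_iff_add_eq]
      exact_mod_cast hcard
    have hle' : ((H.cutEdges (P.merge K hK hKne)).ncard : ℝ) +
        (E(H.induce S) ∩ H.cutEdges P).ncard ≤ (H.cutEdges P).ncard := by exact_mod_cast hle
    rw [hcard'] at h1
    nlinarith
  · -- all sides meet `S`, and the claim is that at most `|∂P|` edges lie inside `S`
    have hKP : K.ncard = H.numSides P := by
      have h3 : K.ncard ≤ H.numSides P := Set.ncard_le_ncard hK (P.finite_parts hV)
      unfold IsMultiwayCut numSides at hm
      unfold numSides at h3 ⊢
      omega
    rw [hKP, h2]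
    exact_mod_cast Set.ncard_le_ncard Set.inter_subset_right hPE

lemma cutEdges_nonempty_of_connected {G : Graph α β} (hconn : G.toSimpleGraph.Connected)
    {P : Partition V(G)} (hP : G.IsMultiwayCut P) : (G.cutEdges P).Nonempty := by
  have h1 : 1 < (P : Set (Set α)).ncard := hP
  obtain ⟨U, W, hU, hW, hUW⟩ := (Set.one_lt_ncard_iff
    (Set.finite_of_ncard_pos (by omega))).1 h1
  obtain ⟨x, hx⟩ := P.nonempty_of_mem hU
  obtain ⟨y, hy⟩ := P.nonempty_of_mem hW
  obtain ⟨p⟩ := hconn.preconnected ⟨x, P.subset_of_mem hU hx⟩ ⟨y, P.subset_of_mem hW hy⟩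
  obtain ⟨d, -, hd1, hd2⟩ := p.exists_boundary_dart {z | (z : α) ∈ U} hx
    (fun h => hUW (P.eq_of_mem_of_mem hU hW h hy))
  obtain ⟨-, e, he⟩ := d.adj
  obtain ⟨B, hB, hyB⟩ := P.mem_iff_exists.1 d.snd.2
  refine ⟨e, _, _, he, U, hU, B, hB, ?_, hd1, hyB⟩
  rintro rfl
  exact hd2 hyB

lemma cutRatio_pos_of_connected {G : Graph α β} (hE : E(G).Finite)
    (hconn : G.toSimpleGraph.Connected) {P : Partition V(G)} (hP : G.IsMultiwayCut P) :
    0 < G.cutRatio P := by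
  refine div_pos ?_ hP.numSides_sub_one_pos
  exact_mod_cast (Set.ncard_pos (hE.subset (G.cutEdges_subset P))).2
    (cutEdges_nonempty_of_connected hconn hP)

/-! ### Existence of hierarchies -/

lemma exists_isMaximalMinRatioCut {H : Graph α β} (hV : V(H).Finite) (h2 : 2 ≤ V(H).ncard) :
    ∃ P, H.IsMaximalMinRatioCut P := by
  have := Partition.finite_of_finite hV
  obtain ⟨P, hP, hmin⟩ := Set.exists_min_image {P | H.IsMultiwayCut P} H.cutRatio
    (Set.toFinite _) ⟨Partition.singletons V(H), h2.trans_eq (Partition.ncard_singletons _).symm⟩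
  obtain ⟨Q, hQ, hmax⟩ := Set.exists_max_image {P | H.IsMinRatioCut P} H.numSides
    (Set.toFinite _) ⟨P, hP, hmin⟩
  exact ⟨Q, hQ, hmax⟩

lemma IsMultiwayCut.ncard_lt {H : Graph α β} (hV : V(H).Finite) {P : Partition V(H)}
    (hP : H.IsMultiwayCut P) {U : Set α} (hU : U ∈ P) : U.ncard < V(H).ncard := by
  refine Set.ncard_lt_ncard ((P.subset_of_mem hU).ssubset_of_ne ?_) hV
  rintro rfl
  have h1 : 1 < (P : Set (Set α)).ncard := hP
  obtain ⟨W, hW, hne⟩ := Set.exists_ne_of_one_lt_ncard h1 V(H)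
  obtain ⟨x, hx⟩ := P.nonempty_of_mem hW
  exact hne (P.eq_of_mem_of_mem hW hU hx (P.subset_of_mem hW hx))

lemma exists_isCanonical (H : Graph α β) (hV : V(H).Finite) (hne : V(H).Nonempty) :
    ∃ T : CutHierarchy H, T.IsCanonical := by
  induction hn : V(H).ncard using Nat.strong_induction_on generalizing H with
  | _ n ih =>
    by_cases h2 : 2 ≤ V(H).ncard
    · obtain ⟨P, hP⟩ := exists_isMaximalMinRatioCut hV h2
      have hchild : ∀ U : P, ∃ T : CutHierarchy (H.induce (U : Set α)), T.IsCanonical :=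
        fun U => ih _ (hn ▸ hP.1.1.ncard_lt hV U.2) (H.induce U)
          (hV.subset (P.subset_of_mem U.2)) (P.nonempty_of_mem U.2) rfl
      choose child hc using hchild
      exact ⟨.node H P hP.1 child, hP, hc⟩
    · have h1 := (Set.ncard_pos hV).2 hne
      have hleaf : ∃ w, V(H) = {w} := Set.ncard_eq_one.1 (by omega)
      exact ⟨.leaf H hleaf, trivial⟩

/-! ### Sums over the edges of a partitioned graph -/

lemma finsum_mem_le_finsum_mem {ι : Type*} {s : Set ι} (hs : s.Finite) {f g : ι → ℝ}
    (h : ∀ i ∈ s, f i ≤ g i) : ∑ᶠ i ∈ s, f i ≤ ∑ᶠ i ∈ s, g i := by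
  rw [finsum_mem_eq_finite_toFinset_sum f hs, finsum_mem_eq_finite_toFinset_sum g hs]
  exact Finset.sum_le_sum fun i hi => h i (hs.mem_toFinset.1 hi)

lemma finsum_mem_const {ι : Type*} {s : Set ι} (hs : s.Finite) (c : ℝ) :
    ∑ᶠ _i ∈ s, c = s.ncard * c := by
  rw [finsum_mem_eq_finite_toFinset_sum _ hs, Finset.sum_const, nsmul_eq_mul,
    Set.ncard_eq_toFinset_card s hs]

lemma edgeSet_induce_eq_union (H : Graph α β) (P : Partition V(H)) {S : Set α} (hS : S ⊆ V(H)) :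
    E(H.induce S) = (E(H.induce S) ∩ H.cutEdges P) ∪
      ⋃ U ∈ (P : Set (Set α)), E(H.induce (S ∩ U)) := by
  refine Set.Subset.antisymm ?_ (Set.union_subset Set.inter_subset_left
    (Set.iUnion₂_subset fun U _ => H.edgeSet_induce_mono Set.inter_subset_left))
  rintro e he
  obtain ⟨x, y, h, hx, hy⟩ := id he
  obtain ⟨U, hU, hxU⟩ := P.mem_iff_exists.1 (hS hx)
  obtain ⟨W, hW, hyW⟩ := P.mem_iff_exists.1 (hS hy)
  by_cases hUW : U = W
  · subst hUW
    exact Or.inr (Set.mem_biUnion hU ⟨x, y, h, ⟨hx, hxU⟩, hy, hyW⟩)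
  · exact Or.inl ⟨he, (h.mem_cutEdges_iff hU hW hxU hyW).2 hUW⟩

/-- A sum over the edges inside `S` splits into the sum over the edges of a cut and the sums over
the edges inside the traces of its sides on `S`. -/
lemma finsum_edgeSet_induce (H : Graph α β) (hV : V(H).Finite) (hE : E(H).Finite)
    (P : Partition V(H)) {S : Set α} (hS : S ⊆ V(H)) (f : β → ℝ) :
    ∑ᶠ e ∈ E(H.induce S), f e = ∑ᶠ e ∈ E(H.induce S) ∩ H.cutEdges P, f e +
      ∑ᶠ U ∈ (P : Set (Set α)), ∑ᶠ e ∈ E(H.induce (S ∩ U)), f e := by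
  have hfin : ∀ A, E(H.induce A).Finite := fun A => hE.subset (H.edgeSet_induce_subset A)
  have hPfin := P.finite_parts hV
  conv_lhs => rw [H.edgeSet_induce_eq_union P hS]
  rw [finsum_mem_union, finsum_mem_biUnion _ hPfin fun U _ => hfin _]
  · intro U hU W hW hUW
    refine Set.disjoint_left.2 ?_
    rintro e ⟨x, y, h, hx, hy⟩ ⟨x', y', h', hx', hy'⟩
    obtain ⟨rfl, rfl⟩ | ⟨rfl, rfl⟩ := h.eq_and_eq_or_eq_and_eq h'
    · exact hUW (P.eq_of_mem_of_mem hU hW hx.2 hx'.2)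
    · exact hUW (P.eq_of_mem_of_mem hU hW hx.2 hy'.2)
  · refine Set.disjoint_left.2 fun e he he' => ?_
    obtain ⟨U, hU, heU⟩ := Set.mem_iUnion₂.1 he'
    exact notMem_cutEdges_of_mem_edgeSet_induce hU Set.inter_subset_right heU he.2
  · exact (hfin S).subset Set.inter_subset_left
  · exact hPfin.biUnion fun U _ => hfin _

lemma finsum_edgeSet (H : Graph α β) (hV : V(H).Finite) (hE : E(H).Finite)
    (P : Partition V(H)) (f : β → ℝ) :
    ∑ᶠ e ∈ E(H), f e = ∑ᶠ e ∈ H.cutEdges P, f e +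
      ∑ᶠ U ∈ (P : Set (Set α)), ∑ᶠ e ∈ E(H.induce U), f e := by
  have h := H.finsum_edgeSet_induce hV hE P subset_rfl f
  rw [H.induce_vertexSet, Set.inter_eq_right.2 (H.cutEdges_subset P)] at h
  rw [h]
  congr 1
  refine finsum_mem_congr rfl fun U hU => ?_
  rw [Set.inter_eq_right.2 (P.subset_of_mem hU)]

lemma finsum_ncard_inter {s : Set α} (hs : s.Finite) (P : Partition s) {S : Set α} (hS : S ⊆ s) :
    ∑ᶠ U ∈ (P : Set (Set α)), ((S ∩ U).ncard : ℝ) = S.ncard := by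
  have hSU : S = ⋃ U ∈ (P : Set (Set α)), S ∩ U := by
    rw [← Set.inter_iUnion₂, ← Set.sUnion_eq_biUnion]
    exact (Set.inter_eq_left.2 (hS.trans P.sUnion_eq.ge)).symm
  have hP := P.finite_parts hs
  conv_rhs => rw [hSU]
  rw [hP.ncard_biUnion (fun U _ => (hs.subset hS).inter_of_left U)
    (fun U hU W hW hUW => (P.disjoint hU hW hUW).mono Set.inter_subset_right
      Set.inter_subset_right), finsum_mem_eq_finite_toFinset_sum _ hP,
    finsum_mem_eq_finite_toFinset_sum _ hP]
  push_cast
  rfl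

/-! ### Ideal loads -/

namespace CutHierarchy

lemma idealLoad_node_of_mem_cutEdges {H : Graph α β} {P : Partition V(H)} {hP : H.IsMinRatioCut P}
    {child : ∀ U : P, CutHierarchy (H.induce (U : Set α))} {e : β} (he : e ∈ H.cutEdges P) :
    (node H P hP child).idealLoad e = 1 / H.cutRatio P := by
  rw [idealLoad, if_pos he]

lemma idealLoad_node_of_mem_edgeSet_induce {H : Graph α β} {P : Partition V(H)}
    {hP : H.IsMinRatioCut P} {child : ∀ U : P, CutHierarchy (H.induce (U : Set α))} {e : β} (U : P)
    (he : e ∈ E(H.induce (U : Set α))) :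
    (node H P hP child).idealLoad e = (child U).idealLoad e := by
  have hex : ∃ W : P, e ∈ E(H.induce (W : Set α)) := ⟨U, he⟩
  rw [idealLoad, if_neg (notMem_cutEdges_of_mem_edgeSet_induce U.2 subset_rfl he), dif_pos hex]
  suffices h : hex.choose = U by rw [h]
  obtain ⟨x, y, hl, hx, hy⟩ := he
  obtain ⟨x', y', hl', hx', hy'⟩ := hex.choose_spec
  obtain ⟨rfl, rfl⟩ | ⟨rfl, rfl⟩ := hl.eq_and_eq_or_eq_and_eq hl'
  · exact Subtype.ext (P.eq_of_mem_of_mem hex.choose.2 U.2 hx' hx)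
  · exact Subtype.ext (P.eq_of_mem_of_mem hex.choose.2 U.2 hx' hy)

lemma finsum_cutEdges_idealLoad {H : Graph α β} (hE : E(H).Finite) {P : Partition V(H)}
    (hP : H.IsMinRatioCut P) (child : ∀ U : P, CutHierarchy (H.induce (U : Set α))) (A : Set β) :
    ∑ᶠ e ∈ A ∩ H.cutEdges P, (node H P hP child).idealLoad e =
      (A ∩ H.cutEdges P).ncard / H.cutRatio P := by
  rw [finsum_mem_congr rfl fun e (he : e ∈ A ∩ H.cutEdges P) =>
    idealLoad_node_of_mem_cutEdges he.2,
    finsum_mem_const ((hE.subset (H.cutEdges_subset P)).subset Set.inter_subset_right),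
    mul_one_div]

lemma idealLoad_pos {H : Graph α β} (T : CutHierarchy H) (hloop : H.Loopless) (hV : V(H).Finite)
    (hE : E(H).Finite) {r : ℝ} (hr : 0 < r) (hH : H.IsStrong r) {e : β} (he : e ∈ E(H)) :
    0 < T.idealLoad e := by
  induction T generalizing r with
  | leaf H hw =>
    obtain ⟨w, hw⟩ := hw
    have := vertexSet_nontrivial_of_edgeSet_nonempty_of_loopless ⟨e, he⟩
    rw [hw] at this
    exact (Set.not_nontrivial_singleton this).elim
  | node H P hP child ih =>
    have hpos := hr.trans_le (hH.le_cutRatio hP.1)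
    by_cases hc : e ∈ H.cutEdges P
    · rw [idealLoad_node_of_mem_cutEdges hc]
      positivity
    · have h := H.edgeSet_induce_eq_union P subset_rfl
      rw [H.induce_vertexSet] at h
      obtain ⟨-, h⟩ | h := h ▸ he
      · exact (hc h).elim
      obtain ⟨U, hU, heU⟩ := Set.mem_iUnion₂.1 h
      rw [Set.inter_eq_right.2 (P.subset_of_mem hU)] at heU
      have : (H.induce U).Loopless := Loopless.anti (H.induce_le (P.subset_of_mem hU))
      rw [idealLoad_node_of_mem_edgeSet_induce ⟨U, hU⟩ heU]
      exact ih ⟨U, hU⟩ this (hV.subset (P.subset_of_mem hU))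
        (hE.subset (H.edgeSet_induce_subset U)) hpos (hP.isStrong_induce hV hE hU) heU

/-- The ideal loads sum to `|V| - 1`: the edges of a cut `P` of the hierarchy contribute
`|P| - 1`. -/
lemma finsum_idealLoad {H : Graph α β} (T : CutHierarchy H) (hV : V(H).Finite)
    (hE : E(H).Finite) {r : ℝ} (hr : 0 < r) (hH : H.IsStrong r) :
    ∑ᶠ e ∈ E(H), T.idealLoad e = (V(H).ncard : ℝ) - 1 := by
  induction T generalizing r with
  | leaf H hw =>
    have h1 : V(H).ncard = 1 := Set.ncard_eq_one.2 hw
    rw [h1]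
    simp [idealLoad]
  | node H P hP child ih =>
    have hpos := hr.trans_le (hH.le_cutRatio hP.1)
    have hPfin := P.finite_parts hV
    have h1 : ∑ᶠ e ∈ H.cutEdges P, (node H P hP child).idealLoad e = (H.numSides P : ℝ) - 1 := by
      have h := finsum_cutEdges_idealLoad hE hP child Set.univ
      rw [Set.univ_inter, ← hP.1.cutRatio_mul, mul_div_cancel_left₀ _ hpos.ne'] at h
      exact h
    have h2 : ∑ᶠ U ∈ (P : Set (Set α)), ∑ᶠ e ∈ E(H.induce U), (node H P hP child).idealLoad e =
        ∑ᶠ U ∈ (P : Set (Set α)), (((V(H) ∩ U).ncard : ℝ) - 1) := by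
      refine finsum_mem_congr rfl fun U hU => ?_
      rw [finsum_mem_congr rfl fun e he => idealLoad_node_of_mem_edgeSet_induce ⟨U, hU⟩ he,
        ih ⟨U, hU⟩ (hV.subset (P.subset_of_mem hU)) (hE.subset (H.edgeSet_induce_subset U))
        hpos (hP.isStrong_induce hV hE hU), Set.inter_eq_right.2 (P.subset_of_mem hU)]
      rfl
    rw [H.finsum_edgeSet hV hE P, h1, h2, finsum_mem_sub_distrib _ _ hPfin,
      finsum_ncard_inter hV P subset_rfl, finsum_mem_const hPfin, numSides]
    ring

/-- The ideal loads satisfy the rank constraints of the spanning tree polytope. If `S` meets `k`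
sides of the root cut, then the edges of the root cut inside `S` have total load at most
`k - 1`. -/
lemma finsum_idealLoad_induce_le {H : Graph α β} (T : CutHierarchy H)
    (hV : V(H).Finite) (hE : E(H).Finite) {r : ℝ} (hr : 0 < r) (hH : H.IsStrong r) {S : Set α}
    (hS : S ⊆ V(H)) (hne : S.Nonempty) :
    ∑ᶠ e ∈ E(H.induce S), T.idealLoad e ≤ (S.ncard : ℝ) - 1 := by
  induction T generalizing r S with
  | leaf H hw =>
    have h1 : (1 : ℝ) ≤ S.ncard := by
      exact_mod_cast (Set.ncard_pos (hV.subset hS)).2 hne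
    simpa [idealLoad] using h1
  | node H P hP child ih =>
    have hpos := hr.trans_le (hH.le_cutRatio hP.1)
    have hPfin := P.finite_parts hV
    set K : Set (Set α) := {U ∈ (P : Set (Set α)) | (S ∩ U).Nonempty} with hK
    have h1 : ∑ᶠ e ∈ E(H.induce S) ∩ H.cutEdges P, (node H P hP child).idealLoad e ≤
        (K.ncard : ℝ) - 1 := by
      rw [finsum_cutEdges_idealLoad hE hP child, div_le_iff₀' hpos]
      exact hP.ncard_edgeSet_induce_inter_cutEdges_le hV hE hS hne
    have h2 : ∑ᶠ U ∈ (P : Set (Set α)), ∑ᶠ e ∈ E(H.induce (S ∩ U)),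
        (node H P hP child).idealLoad e ≤
        ∑ᶠ U ∈ (P : Set (Set α)), (((S ∩ U).ncard : ℝ) - K.indicator 1 U) := by
      refine finsum_mem_le_finsum_mem hPfin fun U hU => ?_
      by_cases hSU : (S ∩ U).Nonempty
      · rw [Set.indicator_of_mem (show U ∈ K from ⟨hU, hSU⟩), finsum_mem_congr rfl fun e he =>
          idealLoad_node_of_mem_edgeSet_induce ⟨U, hU⟩
            (H.edgeSet_induce_mono Set.inter_subset_right he),
          ← H.edgeSet_induce_induce Set.inter_subset_right]
        exact ih ⟨U, hU⟩ (hV.subset (P.subset_of_mem hU)) (hE.subset (H.edgeSet_induce_subset U))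
          hpos (hP.isStrong_induce hV hE hU) Set.inter_subset_right hSU
      · rw [Set.indicator_of_notMem fun h : U ∈ K => hSU h.2, Set.not_nonempty_iff_eq_empty.1 hSU]
        simp [edgeSet_induce]
    have h3 : ∑ᶠ U ∈ (P : Set (Set α)), K.indicator (1 : Set α → ℝ) U = K.ncard := by
      have hKP : K ⊆ P := Set.sep_subset _ _
      rw [finsum_mem_def, Set.indicator_indicator, Set.inter_eq_right.2 hKP, ← finsum_mem_def]
      simpa using finsum_mem_const (hPfin.subset hKP) 1
    rw [finsum_mem_sub_distrib _ _ hPfin, finsum_ncard_inter hV P hS, h3] at h2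
    rw [H.finsum_edgeSet_induce hV hE P hS]
    linarith

/-- The first-order optimality condition in the form that survives the recursion. The weights
`log (ℓ e) + log r` are nonpositive when the graph is `r`-strong and do not increase down the
hierarchy; at the root, the whole graph is charged for the difference between `r` and the ratio of
the root cut. -/
lemma finsum_sub_idealLoad_mul_nonneg {H : Graph α β} (T : CutHierarchy H) (hloop : H.Loopless)
    (hV : V(H).Finite) (hE : E(H).Finite) {r : ℝ} (hr : 0 < r) (hH : H.IsStrong r) {x : β → ℝ}
    (hx : ∀ S ⊆ V(H), S.Nonempty → ∑ᶠ e ∈ E(H.induce S), x e ≤ (S.ncard : ℝ) - 1) :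
    0 ≤ ∑ᶠ e ∈ E(H), (x e - T.idealLoad e) * (Real.log (T.idealLoad e) + Real.log r) := by
  induction T generalizing r with
  | leaf H hw =>
    obtain ⟨w, hw⟩ := hw
    have hempty : E(H) = ∅ := by
      refine Set.not_nonempty_iff_eq_empty.1 fun hne => ?_
      have := vertexSet_nontrivial_of_edgeSet_nonempty_of_loopless hne
      rw [hw] at this
      exact Set.not_nontrivial_singleton this
    rw [hempty, finsum_mem_empty]
  | node H P hP child ih =>
    have hle := hH.le_cutRatio hP.1
    have hpos := hr.trans_le hle
    have hPfin := P.finite_parts hV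
    set ℓ := (node H P hP child).idealLoad
    have hVne : V(H).Nonempty := by
      obtain ⟨U, hU⟩ := Set.nonempty_of_ncard_ne_zero (s := (P : Set (Set α)))
        (by have := hP.1; unfold IsMultiwayCut numSides at this; omega)
      exact (P.nonempty_of_mem hU).mono (P.subset_of_mem hU)
    have hsplit : ∑ᶠ e ∈ E(H), (x e - ℓ e) * (Real.log (ℓ e) + Real.log r) =
        ∑ᶠ e ∈ E(H), (x e - ℓ e) * (Real.log (ℓ e) + Real.log (H.cutRatio P)) +
        (∑ᶠ e ∈ E(H), x e - ∑ᶠ e ∈ E(H), ℓ e) * (Real.log r - Real.log (H.cutRatio P)) := by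
      rw [← finsum_mem_sub_distrib _ _ hE, finsum_mem_mul, ← finsum_mem_add_distrib hE]
      exact finsum_mem_congr rfl fun e _ => by ring
    have htop : 0 ≤ (∑ᶠ e ∈ E(H), x e - ∑ᶠ e ∈ E(H), ℓ e) *
        (Real.log r - Real.log (H.cutRatio P)) := by
      refine mul_nonneg_of_nonpos_of_nonpos ?_ (sub_nonpos.2 (Real.log_le_log hr hle))
      rw [(node H P hP child).finsum_idealLoad hV hE hr hH, sub_nonpos]
      have h := hx V(H) subset_rfl hVne
      rwa [H.induce_vertexSet] at h
    have hcut : ∑ᶠ e ∈ H.cutEdges P,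
        (x e - ℓ e) * (Real.log (ℓ e) + Real.log (H.cutRatio P)) = 0 := by
      refine finsum_mem_eq_zero_of_forall_eq_zero fun e he => ?_
      rw [show ℓ e = 1 / H.cutRatio P from idealLoad_node_of_mem_cutEdges he, one_div,
        Real.log_inv, neg_add_cancel, mul_zero]
    have hsides : ∑ᶠ U ∈ (P : Set (Set α)), (0 : ℝ) ≤ ∑ᶠ U ∈ (P : Set (Set α)),
        ∑ᶠ e ∈ E(H.induce U), (x e - ℓ e) * (Real.log (ℓ e) + Real.log (H.cutRatio P)) := by
      refine finsum_mem_le_finsum_mem hPfin fun U hU => ?_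
      have : (H.induce U).Loopless := Loopless.anti (H.induce_le (P.subset_of_mem hU))
      have h := ih ⟨U, hU⟩ this (hV.subset (P.subset_of_mem hU))
        (hE.subset (H.edgeSet_induce_subset U)) hpos (hP.isStrong_induce hV hE hU) (by
          intro S hS hSne
          exact (H.edgeSet_induce_induce (T := U) hS).symm ▸
            hx S (hS.trans (P.subset_of_mem hU)) hSne)
      refine h.trans_eq (finsum_mem_congr rfl fun e he => ?_)
      rw [show ℓ e = (child ⟨U, hU⟩).idealLoad e from
        idealLoad_node_of_mem_edgeSet_induce ⟨U, hU⟩ he]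
    rw [finsum_mem_zero] at hsides
    rw [hsplit, H.finsum_edgeSet hV hE P, hcut]
    linarith

end CutHierarchy

/-! ### Entropy -/

/-- The tangent line of `t ↦ t log t` at `b > 0` lies strictly below the graph elsewhere. -/
lemma mul_log_add_lt_mul_log {a b : ℝ} (ha : 0 ≤ a) (hb : 0 < b) (hab : a ≠ b) :
    b * Real.log b + (a - b) * (Real.log b + 1) < a * Real.log a := by
  obtain rfl | ha := ha.eq_or_lt
  · simp only [zero_mul]
    linarith
  · have h := Real.log_lt_sub_one_of_pos (div_pos hb ha)
      (fun h => hab ((div_eq_one_iff_eq ha.ne').1 h).symm)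
    rw [Real.log_div hb.ne' ha.ne'] at h
    have h' := mul_lt_mul_of_pos_left h ha
    rw [mul_sub_one, mul_div_cancel₀ _ ha.ne'] at h'
    linarith

lemma sum_mul_log_lt {ι : Type*} (s : Finset ι) {x y : ι → ℝ} (hx : ∀ i ∈ s, 0 ≤ x i)
    (hy : ∀ i ∈ s, 0 < y i) (hne : ∃ i ∈ s, x i ≠ y i) (hsum : ∑ i ∈ s, x i = ∑ i ∈ s, y i)
    (hgrad : 0 ≤ ∑ i ∈ s, (x i - y i) * Real.log (y i)) :
    ∑ i ∈ s, y i * Real.log (y i) < ∑ i ∈ s, x i * Real.log (x i) := by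
  have hlt : ∑ i ∈ s, (y i * Real.log (y i) + (x i - y i) * (Real.log (y i) + 1)) <
      ∑ i ∈ s, x i * Real.log (x i) := by
    refine Finset.sum_lt_sum (fun i hi => ?_) ?_
    · by_cases h : x i = y i
      · rw [h]
        simp
      · exact (mul_log_add_lt_mul_log (hx i hi) (hy i hi) h).le
    · obtain ⟨i, hi, h⟩ := hne
      exact ⟨i, hi, mul_log_add_lt_mul_log (hx i hi) (hy i hi) h⟩
  simp only [mul_add, mul_one, Finset.sum_add_distrib, Finset.sum_sub_distrib, hsum, sub_self,
    add_zero] at hlt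
  linarith

/-- On a hyperplane of constant coordinate sum, the entropy is an affine decreasing function of
`∑ x log x`. -/
lemma edgeEntropy_eq (G : Graph α β) [Fintype E(G)] {x : E(G) → ℝ}
    (hn : (V(G).ncard : ℝ) - 1 ≠ 0) :
    G.edgeEntropy x = ((∑ e, x e) * Real.log ((V(G).ncard : ℝ) - 1) - ∑ e, x e * Real.log (x e)) /
      ((V(G).ncard : ℝ) - 1) := by
  rw [edgeEntropy, Finset.sum_mul, ← Finset.sum_sub_distrib, Finset.sum_div]
  refine Finset.sum_congr rfl fun e _ => ?_
  -- both summands vanish for `x e = 0`, where the logarithm of the quotient does not split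
  by_cases hx : x e = 0
  · simp [hx]
  · rw [Real.log_div hn hx]
    ring

lemma sum_filter_edgeSet_induce (G : Graph α β) [Fintype E(G)] (S : Set α) (f : β → ℝ)
    [DecidablePred fun e : E(G) => (e : β) ∈ E(G.induce S)] :
    ∑ e ∈ Finset.univ.filter (fun e : E(G) => (e : β) ∈ E(G.induce S)), f e =
      ∑ᶠ e ∈ E(G.induce S), f e := by
  classical
  rw [← finsum_mem_coe_finset, ← finsum_mem_image Subtype.val_injective.injOn]
  refine finsum_mem_congr ?_ fun _ _ => rfl
  ext e
  simpa using fun h => G.edgeSet_induce_subset S h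

lemma sum_edgeSet (G : Graph α β) [Fintype E(G)] (f : β → ℝ) :
    ∑ e : E(G), f e = ∑ᶠ e ∈ E(G), f e := by
  rw [← finsum_eq_sum_of_fintype, finsum_set_coe_eq_finsum_mem]

/-- A hierarchy of a connected graph makes the graph `r`-strong for some `r > 0`: the ratio of its
root cut, or any `r` if it is a leaf. -/
lemma CutHierarchy.exists_isStrong {G : Graph α β} (hE : E(G).Finite)
    (hconn : G.toSimpleGraph.Connected) (T : CutHierarchy G) : ∃ r > 0, G.IsStrong r := by
  cases T with
  | leaf _ hw =>
    refine ⟨1, one_pos, fun Q hQ => ?_⟩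
    obtain ⟨w, hw⟩ := hw
    obtain ⟨U, hU⟩ := Set.nonempty_of_ncard_ne_zero (s := (Q : Set (Set α)))
      (by unfold IsMultiwayCut numSides at hQ; omega)
    have hlt := hQ.ncard_lt (by simp [hw]) hU
    have hpos := (Set.ncard_pos ((Set.finite_singleton w).subset
      (hw ▸ Q.subset_of_mem hU))).2 (Q.nonempty_of_mem hU)
    rw [hw, Set.ncard_singleton] at hlt
    omega
  | node _ P hP _ => exact ⟨_, cutRatio_pos_of_connected hE hconn hP.1, hP.isStrong⟩

end Graph

theorem mainTheorem3 {α : Type*} {β : Type*} (G : Graph α β) [Finite V(G)] [Fintype E(G)]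
    (hloop : G.Loopless) (hconn : G.toSimpleGraph.Connected) :
    (∃ T : Graph.CutHierarchy G, T.IsCanonical) ∧
    ∀ T : Graph.CutHierarchy G,
      (fun e : E(G) => T.idealLoad e) ∈ G.spanningTreePolytope ∧
      ∀ x ∈ G.spanningTreePolytope, x ≠ (fun e : E(G) => T.idealLoad e) →
        G.edgeEntropy x < G.edgeEntropy (fun e : E(G) => T.idealLoad e) ∧
        ∑ e : E(G), T.idealLoad e * Real.log (T.idealLoad e) <
          ∑ e : E(G), x e * Real.log (x e) := by
  classical
  have hV : V(G).Finite := Set.toFinite _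
  have hE : E(G).Finite := Set.toFinite _
  refine ⟨G.exists_isCanonical hV (Set.nonempty_coe_sort.1 hconn.nonempty), fun T => ?_⟩
  obtain ⟨r, hr, hG⟩ := T.exists_isStrong hE hconn
  have hpos : ∀ e : E(G), 0 < T.idealLoad e := fun e => T.idealLoad_pos hloop hV hE hr hG e.2
  have hsum : ∑ e : E(G), T.idealLoad e = (V(G).ncard : ℝ) - 1 :=
    (G.sum_edgeSet _).trans (T.finsum_idealLoad hV hE hr hG)
  refine ⟨⟨fun e => ⟨(hpos e).le, ?_⟩, fun S hS hne => ?_, hsum⟩, fun x hx hne => ?_⟩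
  · -- the rank constraint for the two ends of `e`
    obtain ⟨a, b, h⟩ := Graph.exists_isLink_of_mem_edgeSet e.2
    have hab : ({a, b} : Set α) ⊆ V(G) := Set.pair_subset h.left_mem h.right_mem
    have hle := T.finsum_idealLoad_induce_le hV hE hr hG hab ⟨a, by simp⟩
    rw [Set.ncard_pair h.ne, ← G.sum_filter_edgeSet_induce] at hle
    have he : e ∈ Finset.univ.filter fun e : E(G) => (e : β) ∈ E(G.induce {a, b}) :=
      Finset.mem_filter.2 ⟨Finset.mem_univ _, a, b, h, by simp, by simp⟩
    have h1 := Finset.single_le_sum (f := fun e : E(G) => T.idealLoad e)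
      (fun i _ => (hpos i).le) he
    push_cast at hle
    linarith
  · rw [G.sum_filter_edgeSet_induce S T.idealLoad]
    exact T.finsum_idealLoad_induce_le hV hE hr hG hS hne
  · obtain ⟨hx01, hxS, hxsum⟩ := hx
    obtain ⟨e₀, he₀⟩ := Function.ne_iff.1 hne
    -- `x` extended by zero to all of `β`
    set x' : β → ℝ := fun e => if h : e ∈ E(G) then x ⟨e, h⟩ else 0 with hx'
    have hxx' : ∀ e : E(G), x' e = x e := fun e => by simp [hx']
    have hgrad := T.finsum_sub_idealLoad_mul_nonneg hloop hV hE hr hG (x := x') (fun S hS hSne => by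
      have h := hxS S hS hSne
      simp only [← hxx'] at h
      rwa [G.sum_filter_edgeSet_induce S x'] at h)
    rw [← G.sum_edgeSet] at hgrad
    simp only [hxx', mul_add, Finset.sum_add_distrib, ← Finset.sum_mul, Finset.sum_sub_distrib,
      hxsum, hsum, sub_self, zero_mul, add_zero] at hgrad
    have hlt := Graph.sum_mul_log_lt Finset.univ (fun e _ => (hx01 e).1) (fun e _ => hpos e)
      ⟨e₀, Finset.mem_univ _, he₀⟩ (hxsum.trans hsum.symm) hgrad
    refine ⟨?_, hlt⟩
    have hn : (0 : ℝ) < (V(G).ncard : ℝ) - 1 := by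
      rw [← hsum]
      exact Finset.sum_pos (fun e _ => hpos e) ⟨e₀, Finset.mem_univ _⟩
    rw [G.edgeEntropy_eq hn.ne', G.edgeEntropy_eq hn.ne', hxsum, hsum]
    exact div_lt_div_of_pos_right (by linarith) hn
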